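/- Let $P$ be a finite set of points in the plane such that no two distinct points of $P$ lie on a line whose angle with the $x$-axis is a multiple of $\pi/3$. For each $u\in P$, the rays from $u$ at angles $k\pi/3$ ($0\le k\le 5$) divide the plane into six cones with apex $u$. The cones starting (counter-clockwise) at the angles $\pi/3,\pi,5\pi/3$ are called positive and the other three negative. Distances from $u$ inside a cone are compared by orthogonal projection onto the bisector of the cone. The half-$\theta_6$-graph of $P$ has vertex set $P$ and joins each $u\in P$ to the closest point of $P$ (in this sense) in each of its positive cones containing a point of $P$. For $s\in P$ and a negative cone $C$ of $s$, the canonical path of $s$ in $C$ consists of the edges between consecutive (in angular order around $s$) neighbours of $s$ in $C$. The graph $G_9$ is the subgraph of the half-$\theta_6$-graph that contains, for each $s\in P$ and each negative cone $C$ of $s$ in which $s$ has a neighbour, the edge from $s$ to its closest neighbour in $C$ and the edges of the canonical path of $s$ in $C$. All edges are weighted by Euclidean length, and $d_G(u,v)$ denotes the length of a shortest path from $u$ to $v$ in $G$. **Theorem.** $G_9$ is a $3$-spanner of the half-$\theta_6$-graph, that is, it is a subgraph of the half-$\theta_6$-graph and $d_{G_9}(u,v)\le 3\,d_{\text{half-}\theta_6}(u,v)$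 for all $u,v\in P$. Moreover, let $sv$ be an edge of the half-$\theta_6$-graph with $v$ in a negative cone $C$ of $s$. Then the approximation path of $sv$, which consists of the edge from $s$ to its closest neighbour $c$ in $C$ followed by the part of the canonical path of $s$ in $C$ between $c$ and $v$, exists in $G_9$; it has length at most $3|sv|$, and its part from $c$ to $v$ on the canonical path has length at most $2|sv|$. -/

import Mathlib

open scoped NNReal ENNReal

namespace HalfTheta

noncomputable section

/-- The Euclidean plane. -/
abbrev Plane : Type := EuclideanSpace ℝ (Fin 2)

/-- The unit vector at counter-clockwise angle `θ` from the positive `x`-axis. -/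
def unitVec (θ : ℝ) : Plane := !₂[Real.cos θ, Real.sin θ]

/-- The direction of the `k`-th cone boundary ray, at angle `k π / 3`. -/
def ray (k : ℕ) : Plane := unitVec (k * (Real.pi / 3))

/-- The cone with apex `u` between the rays at angles `k π / 3` and `(k + 1) π / 3`. The first ray
(without the apex) belongs to it, the second does not, so that the six cones `k = 0, …, 5`
partition the plane without `u`. -/
def sector (k : ℕ) (u : Plane) : Set Plane :=
  {v | ∃ a b : ℝ, 0 < a ∧ 0 ≤ b ∧ v = u + a • ray k + b • ray (k + 1)}

/-- Signed length of the projection of `v - u` on the bisector of `sector k u`. -/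
def proj (k : ℕ) (u v : Plane) : ℝ :=
  inner ℝ (v - u) (unitVec (k * (Real.pi / 3) + Real.pi / 6))

/-- Index of the positive cone `C i`: `C 0`, `C 1`, `C 2` start at angles `π/3`, `π`, `5π/3`. -/
def posIdx (i : Fin 3) : ℕ := 2 * i.val + 1

/-- Index of the negative cone opposite to `C i`, which starts at an angle larger by `π`
(the angles are understood modulo `2π`). -/
def negIdx (i : Fin 3) : ℕ := 2 * i.val + 4

/-- No two distinct points of `P` lie on a line parallel to a cone boundary. -/
def GeneralPosition (P : Finset Plane) : Prop :=
  ∀ u ∈ P, ∀ v ∈ P, u ≠ v → ∀ (k : ℕ) (r : ℝ), v - u ≠ r • ray k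

/-- `v` is the closest vertex to `u` in the positive cone `C i` of `u`. -/
def IsPosClosest (P : Finset Plane) (u : P) (i : Fin 3) (v : P) : Prop :=
  v.1 ∈ sector (posIdx i) u ∧
    ∀ w : P, w.1 ∈ sector (posIdx i) u → proj (posIdx i) u v ≤ proj (posIdx i) u w

/-- The half-θ₆-graph of `P`: each vertex is joined to the closest vertex in each of its positive
cones. -/
def halfTheta6 (P : Finset Plane) : SimpleGraph P :=
  SimpleGraph.fromRel fun u v => ∃ i, IsPosClosest P u i v

/-- The neighbours of `s` in the half-θ₆-graph that lie in the `i`-th negative cone of `s`. -/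
def negNbrs (P : Finset Plane) (s : P) (i : Fin 3) : Set P :=
  {v | (halfTheta6 P).Adj s v ∧ v.1 ∈ sector (negIdx i) s}

/-- `c` is closest to `s` among the neighbours of `s` in its `i`-th negative cone. -/
def IsNegClosest (P : Finset Plane) (s : P) (i : Fin 3) (c : P) : Prop :=
  c ∈ negNbrs P s i ∧ ∀ w ∈ negNbrs P s i, proj (negIdx i) s c ≤ proj (negIdx i) s w

/-- Seen from `s`, the direction of `w` is obtained from that of `v` by a counter-clockwise turn by
an angle strictly between `0` and `π`. Inside one cone this is the angular order around `s`. -/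
def CCW (s v w : Plane) : Prop :=
  0 < (v - s) 0 * (w - s) 1 - (v - s) 1 * (w - s) 0

/-- `v` and `w` are neighbours of `s` in the `i`-th negative cone of `s`, and `w` comes next after
`v` in the counter-clockwise order around `s` of all these neighbours. -/
def Consecutive (P : Finset Plane) (s : P) (i : Fin 3) (v w : P) : Prop :=
  v ∈ negNbrs P s i ∧ w ∈ negNbrs P s i ∧ CCW s v w ∧
    ∀ x ∈ negNbrs P s i, ¬ (CCW s v x ∧ CCW s x w)

/-- The canonical path of `s` in its `i`-th negative cone: the edges of the half-θ₆-graph between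
consecutive neighbours of `s` in that cone. -/
def canonicalPath (P : Finset Plane) (s : P) (i : Fin 3) : SimpleGraph P :=
  halfTheta6 P ⊓ SimpleGraph.fromRel (Consecutive P s i)

/-- The graph `G₉`: for each vertex `s` and each negative cone of `s`, it keeps the edge from `s` to
its closest neighbour in the cone, and the edges of the canonical path in the cone. -/
def G9 (P : Finset Plane) : SimpleGraph P :=
  SimpleGraph.fromRel (fun s c => ∃ i, IsNegClosest P s i c) ⊔ ⨆ s, ⨆ i, canonicalPath P s i

/-- The length of a walk: the sum of the lengths of its edges. -/
def walkLength {V : Type*} [PseudoMetricSpace V] {G : SimpleGraph V} {u v : V}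
    (p : G.Walk u v) : ℝ :=
  (p.darts.map fun d => dist d.fst d.snd).sum

/-- The weighted graph distance `d_G(u, v)`, which is `∞` if no path joins `u` and `v`. -/
def graphDist {V : Type*} [PseudoMetricSpace V] (G : SimpleGraph V) (u v : V) : ℝ≥0∞ :=
  ⨅ p : G.Walk u v, ENNReal.ofReal (walkLength p)

/-- `H` is a `t`-spanner of `G`. -/
def IsSpanner {V : Type*} [PseudoMetricSpace V] (t : ℝ≥0) (H G : SimpleGraph V) : Prop :=
  1 ≤ t ∧ H ≤ G ∧ ∀ u v : V, graphDist H u v ≤ t * graphDist G u v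

/-- `p` is the approximation path in `G₉` for a vertex `v` in the `i`-th negative cone of `s`: the
edge from `s` to its closest neighbour `c` in this cone, followed by the path from `c` to `v`
along the edges of the canonical path in this cone. -/
def IsApproximationPath (P : Finset Plane) (i : Fin 3) {s v : P} (p : (G9 P).Walk s v) : Prop :=
  ∃ (c : P) (h : (G9 P).Adj s c) (q : (G9 P).Walk c v),
    p = SimpleGraph.Walk.cons h q ∧ IsNegClosest P s i c ∧ q.IsPath ∧
      ∀ e ∈ q.edges, e ∈ (canonicalPath P s i).edgeSet

end

end HalfTheta

/-! Up to sign, `coord (i + 1)` and `coord (i + 2)` are coordinates along the two sides of the cones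
of index `i`. In them a cone is a quadrant, the projection order is the order of the coordinate sum,
and an edge means that a triangle is empty. The neighbours of `s` in a negative cone form an
antichain (`negNbrs_antitone`), so the canonical path is a staircase: one coordinate rises while the
other falls. Consecutive neighbours are adjacent because nothing lies between them
(`Consecutive.adj`), so the path exists. Each edge is at most the sum of its two coordinate changes,
and along a staircase these sums telescope (`JoinsConsecutive.walkLength_le`). Since `c` has the
least coordinate sum, elementary algebra gives the factors 3 and 2 (`length_bounds`). Every edge of
the half-θ₆-graph lies in a negative cone of one endpoint, so the spanner bound follows edge by
edge. -/

namespace HalfTheta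

open SimpleGraph hiding dist dist_comm

noncomputable section

/-! ### Oblique coordinates for cones, orientation and distance. -/

/-- Oblique coordinates: `2 / √3` times the inner product with the bisector of `C i`. -/
def coord (i : Fin 3) (p : Plane) : ℝ :=
  match i with
  | 0 => 2 / √3 * p 1
  | 1 => -p 0 - 1 / √3 * p 1
  | 2 => p 0 - 1 / √3 * p 1

lemma coord_sum (i : Fin 3) (p : Plane) :
    coord i p = -(coord (i + 1) p + coord (i + 2) p) := by
  fin_cases i <;> simp [coord] <;> ring

lemma ray_one : ray 1 = !₂[1 / 2, √3 / 2] := by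
  simp [ray, unitVec]

lemma ray_two : ray 2 = !₂[-(1 / 2), √3 / 2] := by
  have h : ((2 : ℕ) : ℝ) * (Real.pi / 3) = Real.pi - Real.pi / 3 := by push_cast; ring
  simp only [ray, unitVec, h, Real.cos_pi_sub, Real.sin_pi_sub]
  simp

lemma ray_add_three (k : ℕ) : ray (k + 3) = -ray k := by
  have h : ((k + 3 : ℕ) : ℝ) * (Real.pi / 3) = k * (Real.pi / 3) + Real.pi := by push_cast; ring
  simp only [ray, unitVec, h, Real.cos_add_pi, Real.sin_add_pi]
  ext j; fin_cases j <;> simp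

lemma ray_three : ray 3 = !₂[-1, 0] := by
  have h : ((3 : ℕ) : ℝ) * (Real.pi / 3) = Real.pi := by push_cast; ring
  simp only [ray, unitVec, h, Real.cos_pi, Real.sin_pi]

lemma ray_four : ray 4 = -ray 1 := ray_add_three 1
lemma ray_five : ray 5 = -ray 2 := ray_add_three 2
lemma ray_six : ray 6 = -ray 3 := ray_add_three 3

lemma bisector_eq (k : ℕ) :
    unitVec (k * (Real.pi / 3) + Real.pi / 6) = (1 / √3) • (ray k + ray (k + 1)) := by
  have h3' : √3 ≠ 0 := by positivity
  have e : ((k + 1 : ℕ) : ℝ) * (Real.pi / 3) = k * (Real.pi / 3) + Real.pi / 3 := by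
    push_cast; ring
  simp only [ray, unitVec, e, Real.cos_add, Real.sin_add, Real.cos_pi_div_three,
    Real.sin_pi_div_three, Real.cos_pi_div_six, Real.sin_pi_div_six]
  ext j; fin_cases j <;> simp <;> field_simp <;> ring_nf <;> simp <;> ring

lemma proj_posIdx (i : Fin 3) (u v : Plane) :
    proj (posIdx i) u v = √3 / 2 * (coord i v - coord i u) := by
  have h3' : √3 ≠ 0 := by positivity
  rw [proj, bisector_eq]
  fin_cases i <;>
    simp [posIdx, coord, ray_one, ray_two, ray_three, ray_four, ray_five, ray_six,
      PiLp.inner_apply, Fin.sum_univ_two] <;>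
    field_simp <;> ring_nf <;> simp

lemma proj_negIdx (i : Fin 3) (u v : Plane) :
    proj (negIdx i) u v = -proj (posIdx i) u v := by
  have e : negIdx i = posIdx i + 3 := by simp [negIdx, posIdx]
  rw [proj, proj, bisector_eq, bisector_eq, e, ray_add_three,
    show posIdx i + 3 + 1 = posIdx i + 1 + 3 by ring, ray_add_three, ← inner_neg_right]
  congr 1
  module

lemma coord_add (i : Fin 3) (p q : Plane) : coord i (p + q) = coord i p + coord i q := by
  fin_cases i <;> simp [coord] <;> ring

lemma coord_smul (i : Fin 3) (r : ℝ) (p : Plane) : coord i (r • p) = r * coord i p := by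
  fin_cases i <;> simp [coord] <;> ring

lemma coord_sub (i : Fin 3) (p q : Plane) : coord i (p - q) = coord i p - coord i q := by
  fin_cases i <;> simp [coord] <;> ring

lemma coord_ray_posIdx (i : Fin 3) :
    coord (i + 1) (ray (posIdx i)) = -1 ∧ coord (i + 2) (ray (posIdx i)) = 0 := by
  have h3' : √3 ≠ 0 := by positivity
  fin_cases i <;> simp [coord, posIdx, ray_one, ray_three, ray_five, ray_two] <;>
    field_simp <;> norm_num

lemma coord_ray_posIdx_succ (i : Fin 3) :
    coord (i + 1) (ray (posIdx i + 1)) = 0 ∧ coord (i + 2) (ray (posIdx i + 1)) = -1 := by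
  have h3' : √3 ≠ 0 := by positivity
  fin_cases i <;> simp [coord, posIdx, ray_one, ray_three, ray_four, ray_six, ray_two] <;>
    field_simp <;> norm_num

lemma ext_coord (i : Fin 3) {p q : Plane} (h1 : coord (i + 1) p = coord (i + 1) q)
    (h2 : coord (i + 2) p = coord (i + 2) q) : p = q := by
  have h0 : coord i p = coord i q := by rw [coord_sum, h1, h2, ← coord_sum]
  have h3 : 0 < √3 := by positivity
  have key : coord 0 p = coord 0 q ∧ coord 2 p = coord 2 q := by
    fin_cases i <;> simp_all
  obtain ⟨k0, k2⟩ := key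
  simp only [coord] at k0 k2
  have e1 : p 1 = q 1 := mul_left_cancel₀ (by positivity) k0
  have e0 : p 0 = q 0 := by rw [e1] at k2; linarith
  ext j; fin_cases j <;> assumption

lemma eq_combination (i : Fin 3) (p : Plane) :
    p = (-coord (i + 1) p) • ray (posIdx i) + (-coord (i + 2) p) • ray (posIdx i + 1) := by
  apply ext_coord i <;>
  simp only [coord_add, coord_smul, (coord_ray_posIdx i).1, (coord_ray_posIdx i).2,
    (coord_ray_posIdx_succ i).1, (coord_ray_posIdx_succ i).2] <;> ring

lemma mem_sector_posIdx_iff (i : Fin 3) (u v : Plane) :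
    v ∈ sector (posIdx i) u ↔
      coord (i + 1) v < coord (i + 1) u ∧ coord (i + 2) v ≤ coord (i + 2) u := by
  constructor
  · rintro ⟨a, b, ha, hb, rfl⟩
    simp only [coord_add, coord_smul, (coord_ray_posIdx i).1, (coord_ray_posIdx i).2,
      (coord_ray_posIdx_succ i).1, (coord_ray_posIdx_succ i).2]
    constructor <;> linarith
  · rintro ⟨h1, h2⟩
    refine ⟨-coord (i + 1) (v - u), -coord (i + 2) (v - u), ?_, ?_, ?_⟩
    · rw [coord_sub]; linarith
    · rw [coord_sub]; linarith
    · rw [add_assoc, ← eq_combination i (v - u)]; abel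

lemma mem_sector_negIdx_iff (i : Fin 3) (u v : Plane) :
    v ∈ sector (negIdx i) u ↔
      coord (i + 1) u < coord (i + 1) v ∧ coord (i + 2) u ≤ coord (i + 2) v := by
  have e : negIdx i = posIdx i + 3 := by simp [negIdx, posIdx]
  have e' : posIdx i + 3 + 1 = posIdx i + 1 + 3 := by ring
  rw [← mem_sector_posIdx_iff]
  simp only [sector, Set.mem_ofPred_eq, e, e', ray_add_three]
  refine exists_congr fun a => exists_congr fun b => and_congr_right fun _ =>
    and_congr_right fun _ => ⟨?_, ?_⟩ <;> rintro rfl <;> module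

/-- The change to oblique coordinates multiplies the determinant by `2 / √3`, so its sign is kept.
-/
lemma ccw_iff (i : Fin 3) (s v w : Plane) :
    CCW s v w ↔ 0 < (coord (i + 1) v - coord (i + 1) s) * (coord (i + 2) w - coord (i + 2) s) -
      (coord (i + 2) v - coord (i + 2) s) * (coord (i + 1) w - coord (i + 1) s) := by
  have h3 : 0 < 2 / √3 := by positivity
  rw [CCW, ← mul_pos_iff_of_pos_left h3, ← coord_sub, ← coord_sub, ← coord_sub, ← coord_sub]
  apply iff_of_eq
  congr 1
  fin_cases i <;> simp [coord] <;> ring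

/-- By `eq_combination` the coordinates refer to two unit vectors at angle `π / 3`, whose inner
product is `1 / 2`; hence the cross term. -/
lemma dist_sq_eq (i : Fin 3) (p q : Plane) :
    dist p q ^ 2 = (coord (i + 1) p - coord (i + 1) q) ^ 2 +
      (coord (i + 1) p - coord (i + 1) q) * (coord (i + 2) p - coord (i + 2) q) +
      (coord (i + 2) p - coord (i + 2) q) ^ 2 := by
  have h3 : √3 ^ 2 = 3 := Real.sq_sqrt (by norm_num)
  have h3' : √3 ≠ 0 := by positivity
  rw [dist_eq_norm, EuclideanSpace.norm_sq_eq, Fin.sum_univ_two, ← coord_sub, ← coord_sub]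
  fin_cases i <;> simp [coord] <;> field_simp <;> linear_combination ((p 1 - q 1) ^ 2) * h3

lemma dist_le_coord (i : Fin 3) (p q : Plane) :
    dist p q ≤ |coord (i + 1) p - coord (i + 1) q| + |coord (i + 2) p - coord (i + 2) q| := by
  apply le_of_sq_le_sq _ (by positivity)
  rw [dist_sq_eq i, add_sq, sq_abs, sq_abs, mul_assoc, ← abs_mul]
  have := le_abs_self ((coord (i + 1) p - coord (i + 1) q) * (coord (i + 2) p - coord (i + 2) q))
  have := abs_nonneg ((coord (i + 1) p - coord (i + 1) q) * (coord (i + 2) p - coord (i + 2) q))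
  linarith

lemma coord_injOn {P : Finset Plane} (hP : GeneralPosition P) (j : Fin 3) {u v : P}
    (h : coord j u = coord j v) : u = v := by
  by_contra hne
  have hne' : u.1 ≠ v.1 := fun e => hne (Subtype.ext e)
  obtain ⟨i, rfl⟩ : ∃ i : Fin 3, j = i + 1 := ⟨j - 1, by simp⟩
  -- Level lines of `coord (i + 1)` are parallel to this ray.
  refine hP u u.2 v v.2 hne' (posIdx i + 1) (-coord (i + 2) (v.1 - u.1)) ?_
  conv_lhs => rw [eq_combination i (v.1 - u.1)]
  rw [coord_sub (i + 1), h]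
  simp

/-! ### Negative neighbours, canonical paths and existence of approximation paths. -/

section Graph

variable {P : Finset Plane}

lemma isPosClosest_iff (hP : GeneralPosition P) {u v : P} {i : Fin 3} :
    IsPosClosest P u i v ↔
      (coord (i + 1) v < coord (i + 1) u ∧ coord (i + 2) v < coord (i + 2) u) ∧
      ∀ w : P, coord (i + 1) w < coord (i + 1) u → coord (i + 2) w < coord (i + 2) u →
        coord i v ≤ coord i w := by
  have hs (w : P) : w.1 ∈ sector (posIdx i) u ↔
      coord (i + 1) w < coord (i + 1) u ∧ coord (i + 2) w < coord (i + 2) u := by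
    rw [mem_sector_posIdx_iff]
    refine and_congr_right fun h => ⟨fun h2 => lt_of_le_of_ne h2 fun e => ?_, le_of_lt⟩
    rw [coord_injOn hP _ e] at h
    exact lt_irrefl _ h
  have h3 : 0 < √3 / 2 := by positivity
  simp only [IsPosClosest, hs, proj_posIdx, mul_le_mul_iff_right₀ h3, sub_le_sub_iff_right,
    and_imp]

lemma mem_sector_negIdx_iff_lt (hP : GeneralPosition P) {s v : P} {i : Fin 3} :
    v.1 ∈ sector (negIdx i) s ↔
      coord (i + 1) s < coord (i + 1) v ∧ coord (i + 2) s < coord (i + 2) v := by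
  rw [mem_sector_negIdx_iff]
  refine and_congr_right fun h => ⟨fun h2 => lt_of_le_of_ne h2 fun e => ?_, le_of_lt⟩
  rw [coord_injOn hP _ e] at h
  exact lt_irrefl _ h

lemma halfTheta6_adj_iff (hP : GeneralPosition P) {u v : P} :
    (halfTheta6 P).Adj u v ↔ ∃ i, IsPosClosest P u i v ∨ IsPosClosest P v i u := by
  rw [halfTheta6, fromRel_adj, ← exists_or]
  refine and_iff_right_of_imp ?_
  rintro ⟨i, h | h⟩ rfl <;> exact lt_irrefl _ ((isPosClosest_iff hP).1 h).1.1

/-- The signs of the three coordinate differences determine both the direction of the edge and the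
index of its cone. -/
lemma mem_negNbrs_iff_isPosClosest (hP : GeneralPosition P) {s v : P} {i : Fin 3} :
    v ∈ negNbrs P s i ↔ IsPosClosest P v i s := by
  rw [negNbrs, Set.mem_ofPred_eq, halfTheta6_adj_iff hP, mem_sector_negIdx_iff_lt hP]
  constructor
  · rintro ⟨⟨j, h | h⟩, h1, h2⟩
    · exfalso
      obtain ⟨⟨h3, h4⟩, -⟩ := (isPosClosest_iff hP).1 h
      have := coord_sum i s
      have := coord_sum i v
      fin_cases i <;> fin_cases j <;> simp at * <;> linarith
    · suffices j = i by rwa [← this]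
      obtain ⟨⟨h3, h4⟩, -⟩ := (isPosClosest_iff hP).1 h
      have := coord_sum i s
      have := coord_sum i v
      fin_cases i <;> fin_cases j <;> simp at * <;> linarith
  · intro h
    exact ⟨⟨i, Or.inr h⟩, ((isPosClosest_iff hP).1 h).1⟩

/-- Membership in `negNbrs` as emptiness of a triangle. -/
lemma mem_negNbrs_iff (hP : GeneralPosition P) {s v : P} {i : Fin 3} :
    v ∈ negNbrs P s i ↔
      (coord (i + 1) s < coord (i + 1) v ∧ coord (i + 2) s < coord (i + 2) v) ∧
      ∀ w : P, coord (i + 1) w < coord (i + 1) v → coord (i + 2) w < coord (i + 2) v →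
        coord (i + 1) w + coord (i + 2) w ≤ coord (i + 1) s + coord (i + 2) s := by
  rw [mem_negNbrs_iff_isPosClosest hP, isPosClosest_iff hP]
  simp only [coord_sum i, neg_le_neg_iff]

lemma exists_adj_negNbrs (hP : GeneralPosition P) {u v : P} (h : (halfTheta6 P).Adj u v) :
    ∃ i, v ∈ negNbrs P u i ∨ u ∈ negNbrs P v i := by
  simp only [mem_negNbrs_iff_isPosClosest hP]
  simpa only [or_comm] using (halfTheta6_adj_iff hP).1 h

/-- The neighbours in a negative cone form an antichain. -/
lemma negNbrs_antitone (hP : GeneralPosition P) {s v w : P} {i : Fin 3} (hv : v ∈ negNbrs P s i)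
    (hw : w ∈ negNbrs P s i) :
    coord (i + 1) v < coord (i + 1) w ↔ coord (i + 2) w < coord (i + 2) v := by
  -- Otherwise `x` would lie in the positive cone of `y` strictly closer than `s`.
  have key {x y : P} (hx : x ∈ negNbrs P s i) (hy : y ∈ negNbrs P s i) :
      ¬ (coord (i + 1) x < coord (i + 1) y ∧ coord (i + 2) x < coord (i + 2) y) := by
    rintro ⟨h1, h2⟩
    have := ((mem_negNbrs_iff hP).1 hy).2 x h1 h2
    have := ((mem_negNbrs_iff hP).1 hx).1
    linarith
  constructor
  · intro h
    rcases lt_trichotomy (coord (i + 2) w) (coord (i + 2) v) with h' | h' | h'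
    · exact h'
    · rw [coord_injOn hP _ h'] at h
      exact absurd h (lt_irrefl _)
    · exact absurd ⟨h, h'⟩ (key hv hw)
  · intro h
    rcases lt_trichotomy (coord (i + 1) v) (coord (i + 1) w) with h' | h' | h'
    · exact h'
    · rw [coord_injOn hP _ h'] at h
      exact absurd h (lt_irrefl _)
    · exact absurd ⟨h', h⟩ (key hw hv)

lemma ccw_iff_lt (hP : GeneralPosition P) {s v w : P} {i : Fin 3} (hv : v ∈ negNbrs P s i)
    (hw : w ∈ negNbrs P s i) : CCW s v w ↔ coord (i + 1) w < coord (i + 1) v := by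
  rw [ccw_iff i]
  obtain ⟨v1, v2⟩ := ((mem_negNbrs_iff hP).1 hv).1
  obtain ⟨w1, w2⟩ := ((mem_negNbrs_iff hP).1 hw).1
  constructor
  · intro h
    by_contra! h'
    rcases h'.lt_or_eq with h1 | h1
    · have h2 := (negNbrs_antitone hP hv hw).1 h1
      nlinarith
    · rw [coord_injOn hP _ h1] at h
      linarith
  · intro h1
    have h2 := (negNbrs_antitone hP hw hv).1 h1
    nlinarith

lemma consecutive_iff (hP : GeneralPosition P) {s v w : P} {i : Fin 3} :
    Consecutive P s i v w ↔ v ∈ negNbrs P s i ∧ w ∈ negNbrs P s i ∧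
      coord (i + 1) w < coord (i + 1) v ∧
      ∀ x ∈ negNbrs P s i, ¬ (coord (i + 1) w < coord (i + 1) x ∧
        coord (i + 1) x < coord (i + 1) v) := by
  refine and_congr_right fun hv => and_congr_right fun hw => and_congr (ccw_iff_lt hP hv hw) ?_
  refine forall₂_congr fun x hx => ?_
  rw [ccw_iff_lt hP hv hx, ccw_iff_lt hP hx hw, and_comm]

/-- The parallelogram spanned by two consecutive neighbours contains no point of `P`. -/
lemma Consecutive.not_between (hP : GeneralPosition P) {s v w : P} {i : Fin 3}
    (h : Consecutive P s i v w) (x : P) (h1 : coord (i + 1) w < coord (i + 1) x)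
    (h2 : coord (i + 1) x < coord (i + 1) v) (h3 : coord (i + 2) v < coord (i + 2) x)
    (h4 : coord (i + 2) x < coord (i + 2) w) : False := by
  obtain ⟨hv, hw, -, hno⟩ := (consecutive_iff hP).1 h
  obtain ⟨⟨hv1, hv2⟩, hv3⟩ := (mem_negNbrs_iff hP).1 hv
  obtain ⟨⟨hw1, hw2⟩, hw3⟩ := (mem_negNbrs_iff hP).1 hw
  let S : Set P := {x | (coord (i + 1) w < coord (i + 1) x ∧ coord (i + 1) x < coord (i + 1) v) ∧
    coord (i + 2) v < coord (i + 2) x ∧ coord (i + 2) x < coord (i + 2) w}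
  -- A point of the parallelogram closest to `s` has an empty triangle: the triangles of `v` and `w`
  -- cover what lies outside the parallelogram. It is then a neighbour of `s` between `v` and `w`.
  obtain ⟨y, ⟨⟨y1, y2⟩, y3, y4⟩, hmin⟩ := Set.exists_min_image S
    (fun z : P => coord (i + 1) z + coord (i + 2) z) S.toFinite ⟨x, ⟨h1, h2⟩, h3, h4⟩
  refine hno y ((mem_negNbrs_iff hP).2 ⟨⟨hw1.trans y1, hv2.trans y3⟩, fun z z1 z2 => ?_⟩) ⟨y1, y2⟩
  rcases lt_trichotomy (coord (i + 1) z) (coord (i + 1) w) with hz | hz | hz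
  · exact hw3 z hz (z2.trans y4)
  · rw [coord_injOn hP _ hz] at z2
    exact absurd z2 (not_lt.2 y4.le)
  rcases lt_trichotomy (coord (i + 2) z) (coord (i + 2) v) with hz' | hz' | hz'
  · exact hv3 z (z1.trans y2) hz'
  · rw [coord_injOn hP _ hz'] at z1
    exact absurd z1 (not_lt.2 y2.le)
  have := hmin z ⟨⟨hz, z1.trans y2⟩, hz', z2.trans y4⟩
  linarith

/-- Consecutive neighbours in a negative cone are adjacent. -/
lemma Consecutive.adj (hP : GeneralPosition P) {s v w : P} {i : Fin 3}
    (h : Consecutive P s i v w) : (halfTheta6 P).Adj v w := by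
  obtain ⟨hv, hw, hlt, hno⟩ := (consecutive_iff hP).1 h
  obtain ⟨⟨hv1, hv2⟩, hv3⟩ := (mem_negNbrs_iff hP).1 hv
  obtain ⟨⟨hw1, hw2⟩, hw3⟩ := (mem_negNbrs_iff hP).1 hw
  have hlt2 := (negNbrs_antitone hP hw hv).1 hlt
  have e1 : i + 1 + 1 = i + 2 := by fin_cases i <;> rfl
  have e2 : i + 1 + 2 = i := by fin_cases i <;> rfl
  have e3 : i + 2 + 1 = i := by fin_cases i <;> rfl
  have e4 : i + 2 + 2 = i + 1 := by fin_cases i <;> rfl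
  have sv := coord_sum i v
  have sw := coord_sum i w
  have ss := coord_sum i s
  -- a point in the triangle spanned by `v` and `w` lies in the parallelogram
  have key (x : P) (x1 : coord (i + 1) x < coord (i + 1) v) (x2 : coord (i + 2) x < coord (i + 2) w)
      (x0 : coord (i + 1) s + coord (i + 2) s < coord (i + 1) x + coord (i + 2) x) : False := by
    rcases lt_trichotomy (coord (i + 1) x) (coord (i + 1) w) with hz | hz | hz
    · have := hw3 x hz x2
      linarith
    · rw [coord_injOn hP _ hz] at x2
      exact lt_irrefl _ x2
    rcases lt_trichotomy (coord (i + 2) x) (coord (i + 2) v) with hz' | hz' | hz'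
    · have := hv3 x x1 hz'
      linarith
    · rw [coord_injOn hP _ hz'] at x1
      exact lt_irrefl _ x1
    exact h.not_between hP x hz x1 hz' x2
  rw [halfTheta6_adj_iff hP]
  -- Whichever of `v`, `w` has the larger `coord i` sees the other in a positive cone.
  rcases lt_trichotomy (coord i v) (coord i w) with h0 | h0 | h0
  · refine ⟨i + 1, Or.inr ((isPosClosest_iff hP).2 ?_)⟩
    rw [e1, e2]
    refine ⟨⟨hlt2, h0⟩, fun x x2 x0 => not_lt.1 fun x1 => key x x1 x2 ?_⟩
    have := coord_sum i x
    linarith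
  · rw [coord_injOn hP _ h0] at hlt
    exact absurd hlt (lt_irrefl _)
  · refine ⟨i + 2, Or.inl ((isPosClosest_iff hP).2 ?_)⟩
    rw [e3, e4]
    refine ⟨⟨h0, hlt⟩, fun x x0 x1 => not_lt.1 fun x2 => key x x1 x2 ?_⟩
    have := coord_sum i x
    linarith

/-- By `Consecutive.adj`, intersecting with the half-θ₆-graph removes no edge. -/
lemma canonicalPath_adj_iff (hP : GeneralPosition P) {s v w : P} {i : Fin 3} :
    (canonicalPath P s i).Adj v w ↔ Consecutive P s i v w ∨ Consecutive P s i w v := by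
  rw [canonicalPath, inf_adj, fromRel_adj]
  refine ⟨fun h => h.2.2, fun h => ?_⟩
  have := h.elim (Consecutive.adj hP) fun h => (h.adj hP).symm
  exact ⟨this, this.ne, h⟩

lemma canonicalPath_le_G9 (s : P) (i : Fin 3) : canonicalPath P s i ≤ G9 P :=
  (le_iSup₂_of_le (f := fun s i => canonicalPath P s i) s i le_rfl).trans le_sup_right

lemma IsNegClosest.adj {s c : P} {i : Fin 3} (h : IsNegClosest P s i c) : (G9 P).Adj s c :=
  Or.inl ((fromRel_adj _ _ _).2 ⟨h.1.1.ne, Or.inl ⟨i, h⟩⟩)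

lemma G9_le_halfTheta6 : G9 P ≤ halfTheta6 P := by
  refine sup_le ?_ (iSup₂_le fun s i => inf_le_left)
  intro u v h
  obtain ⟨-, ⟨i, h⟩ | ⟨i, h⟩⟩ := (fromRel_adj _ _ _).1 h
  · exact h.1.1
  · exact h.1.1.symm

lemma reachable_canonicalPath (hP : GeneralPosition P) {s c v : P} {i : Fin 3}
    (hc : c ∈ negNbrs P s i) (hv : v ∈ negNbrs P s i) : (canonicalPath P s i).Reachable c v := by
  have key (c : P) (hc : c ∈ negNbrs P s i) (v : P) :
      v ∈ negNbrs P s i → coord (i + 1) c ≤ coord (i + 1) v →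
        (canonicalPath P s i).Reachable c v := by
    have wf : WellFounded fun x y : P => coord (i + 1) x < coord (i + 1) y :=
      haveI : IsTrans P fun x y => coord (i + 1) x < coord (i + 1) y := ⟨fun _ _ _ => lt_trans⟩
      haveI : Std.Irrefl fun x y : P => coord (i + 1) x < coord (i + 1) y := ⟨fun _ => lt_irrefl _⟩
      Finite.wellFounded_of_trans_of_irrefl _
    induction v using wf.induction with
    | _ v ih =>
      intro hv hle
      rcases hle.eq_or_lt with h | h
      · rw [coord_injOn hP _ h]
      let S : Set P := {x | x ∈ negNbrs P s i ∧ coord (i + 1) x < coord (i + 1) v}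
      -- The predecessor of `v` in the order of `coord (i + 1)`.
      obtain ⟨x, ⟨hx, hxv⟩, hmax⟩ := Set.exists_max_image S (fun z : P => coord (i + 1) z)
        S.toFinite ⟨c, hc, h⟩
      refine (ih x hxv hx (hmax c ⟨hc, h⟩)).trans (Adj.reachable ?_)
      refine (canonicalPath_adj_iff hP).2 (Or.inr ((consecutive_iff hP).2 ⟨hv, hx, hxv, ?_⟩))
      rintro y hy ⟨h1, h2⟩
      exact absurd h1 (not_lt.2 (hmax y ⟨hy, h2⟩))
  rcases le_total (coord (i + 1) c) (coord (i + 1) v) with h | h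
  · exact key c hc v hv h
  · exact (key v hv c hc h).symm

lemma exists_isApproximationPath (hP : GeneralPosition P) {s v : P} {i : Fin 3}
    (hv : v ∈ negNbrs P s i) : ∃ p : (G9 P).Walk s v, IsApproximationPath P i p := by
  obtain ⟨c, hc, hmin⟩ := Set.exists_min_image (negNbrs P s i) (fun w : P => proj (negIdx i) s w)
    (Set.toFinite _) ⟨v, hv⟩
  have hcl : IsNegClosest P s i c := ⟨hc, hmin⟩
  obtain ⟨q, hq⟩ := (reachable_canonicalPath hP hc hv).exists_isPath
  refine ⟨.cons hcl.adj (q.mapLe (canonicalPath_le_G9 s i)), c, hcl.adj, _, rfl, hcl, ?_, ?_⟩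
  · exact hq.mapLe _
  · intro e he
    rw [Walk.edges_mapLe_eq_edges] at he
    exact q.edges_subset_edgeSet he

end Graph

/-! ### Monotone paths, walk lengths and the spanner criterion. -/

section MonotonePath

variable {V : Type*} {G K : SimpleGraph V} {N : Set V} {A : V → ℝ}

/-- The edges of `K` join points of `N` that are consecutive for the values of `A`. -/
def JoinsConsecutive (K : SimpleGraph V) (N : Set V) (A : V → ℝ) : Prop :=
  ∀ x y, K.Adj x y → x ∈ N ∧ y ∈ N ∧ ∀ z ∈ N, ¬ (A x < A z ∧ A z < A y)

lemma JoinsConsecutive.neg (hK : JoinsConsecutive K N A) :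
    JoinsConsecutive K N (fun x => -A x) := by
  intro x y h
  obtain ⟨h1, h2, -⟩ := hK x y h
  refine ⟨h1, h2, fun z hz h' => (hK y x h.symm).2.2 z hz ?_⟩
  simpa [and_comm] using h'

/-- A path whose first step goes down keeps going down. -/
lemma JoinsConsecutive.le_of_isPath (hK : JoinsConsecutive K N A) (hA : Set.InjOn A N)
    {y v : V} (q : G.Walk y v) : ∀ x, q.IsPath → (∀ e ∈ q.edges, e ∈ K.edgeSet) →
      x ∉ q.support → K.Adj x y → A y < A x → A v ≤ A y := by
  induction q with
  | nil => intros; exact le_rfl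
  | @cons y z v h q ih =>
    intro x hq he hx hxy hlt
    rw [Walk.cons_isPath_iff] at hq
    simp only [Walk.edges_cons, List.mem_cons, forall_eq_or_imp, mem_edgeSet] at he
    simp only [Walk.support_cons, List.mem_cons, not_or] at hx
    obtain ⟨hyN, hzN, hyz⟩ := hK y z he.1
    obtain ⟨-, hxN, hyx⟩ := hK y x hxy.symm
    rcases lt_trichotomy (A z) (A y) with h1 | h1 | h1
    · exact (ih y hq.1 he.2 hq.2 he.1 h1).trans h1.le
    · exact absurd (hA hzN hyN h1) he.1.ne'
    -- After a turn at `y`, both `x` and `z` would lie just above `y`, hence coincide, which a path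
    -- forbids.
    · exfalso
      have hzx : z ≠ x := fun e => hx.2 (e ▸ q.start_mem_support)
      rcases lt_trichotomy (A z) (A x) with h2 | h2 | h2
      · exact hyx z hzN ⟨h1, h2⟩
      · exact hzx (hA hzN hxN h2)
      · exact hyz x hxN ⟨hlt, h2⟩

variable [PseudoMetricSpace V]

@[simp]
lemma walkLength_nil {u : V} : walkLength (Walk.nil : G.Walk u u) = 0 := by
  simp [walkLength]

@[simp]
lemma walkLength_cons {u v w : V} (h : G.Adj u v) (p : G.Walk v w) :
    walkLength (Walk.cons h p) = dist u v + walkLength p := by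
  simp [walkLength]

/-- The length of an increasing path telescopes. -/
lemma JoinsConsecutive.walkLength_le (hK : JoinsConsecutive K N A) (hA : Set.InjOn A N)
    {F : V → ℝ} (hF : ∀ x ∈ N, ∀ y ∈ N, A x < A y → dist x y ≤ F y - F x) {x v : V}
    (q : G.Walk x v) : q.IsPath → (∀ e ∈ q.edges, e ∈ K.edgeSet) → v ∈ N → A x ≤ A v →
      walkLength q ≤ F v - F x := by
  induction q with
  | nil => intros; simp
  | @cons x y v h q ih =>
    intro hq he hv hle
    rw [Walk.cons_isPath_iff] at hq
    simp only [Walk.edges_cons, List.mem_cons, forall_eq_or_imp, mem_edgeSet] at he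
    obtain ⟨hxN, hyN, -⟩ := hK x y he.1
    rcases lt_trichotomy (A y) (A x) with h1 | h1 | h1
    · have := hK.le_of_isPath hA q x hq.1 he.2 hq.2 he.1 h1
      linarith
    · exact absurd (hA hyN hxN h1) he.1.ne'
    · have hA' : Set.InjOn (fun x => -A x) N := fun a ha b hb e => hA ha hb (neg_injective e)
      -- Negating `A` turns the statement on descending paths into one on ascending paths.
      have h2 := hK.neg.le_of_isPath hA' q x hq.1 he.2 hq.2 he.1 (neg_lt_neg h1)
      have h3 := ih hq.1 he.2 hv (neg_le_neg_iff.1 h2)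
      have h4 := hF x hxN y hyN h1
      rw [walkLength_cons]
      linarith

lemma walkLength_append {u v w : V} (p : G.Walk u v) (q : G.Walk v w) :
    walkLength (p.append q) = walkLength p + walkLength q := by
  simp [walkLength]

lemma walkLength_reverse {u v : V} (p : G.Walk u v) : walkLength p.reverse = walkLength p := by
  induction p with
  | nil => simp
  | cons h p ih =>
    rw [Walk.reverse_cons, walkLength_append, walkLength_cons, walkLength_cons, walkLength_nil, ih,
      dist_comm]
    ring

/-- Replacing each edge of a walk in `G` by its detour in `H` multiplies the length by at most `t`.
-/
lemma isSpanner_of_forall_adj {t : ℝ≥0} {H G : SimpleGraph V} (ht : 1 ≤ t) (hle : H ≤ G)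
    (h : ∀ u v, G.Adj u v → ∃ p : H.Walk u v, walkLength p ≤ t * dist u v) : IsSpanner t H G := by
  refine ⟨ht, hle, fun u v => ?_⟩
  have key {u v : V} (q : G.Walk u v) : ∃ p : H.Walk u v, walkLength p ≤ t * walkLength q := by
    induction q with
    | nil => exact ⟨.nil, by simp⟩
    | cons hadj q ih =>
      obtain ⟨p, hp⟩ := ih
      obtain ⟨p', hp'⟩ := h _ _ hadj
      refine ⟨p'.append p, ?_⟩
      rw [walkLength_append, walkLength_cons]
      linarith
  rw [graphDist, graphDist, ENNReal.mul_iInf_of_ne (by positivity) (by simp)]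
  refine le_iInf fun q => ?_
  obtain ⟨p, hp⟩ := key q
  refine (iInf_le _ p).trans ((ENNReal.ofReal_le_ofReal hp).trans_eq ?_)
  rw [ENNReal.ofReal_mul t.coe_nonneg, ENNReal.ofReal_coe_nnreal]

end MonotonePath

/-! ### The bounds 3 and 2 for approximation paths. -/

section Bound

variable {P : Finset Plane}

lemma joinsConsecutive_fst (hP : GeneralPosition P) (s : P) (i : Fin 3) :
    JoinsConsecutive (canonicalPath P s i) (negNbrs P s i) (fun x => coord (i + 1) x) := by
  intro x y h
  rcases (canonicalPath_adj_iff hP).1 h with h | h <;>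
    obtain ⟨h1, h2, h3, h4⟩ := (consecutive_iff hP).1 h
  · exact ⟨h1, h2, fun z _ hz => lt_asymm h3 (hz.1.trans hz.2)⟩
  · exact ⟨h2, h1, h4⟩

/-- The antichain property reverses the order. Both versions are needed, as `v` may lie on either
side of `c`. -/
lemma joinsConsecutive_snd (hP : GeneralPosition P) (s : P) (i : Fin 3) :
    JoinsConsecutive (canonicalPath P s i) (negNbrs P s i) (fun x => coord (i + 2) x) := by
  intro x y h
  obtain ⟨hx, hy, -⟩ := joinsConsecutive_fst hP s i x y h
  refine ⟨hx, hy, fun z hz h' => (joinsConsecutive_fst hP s i y x h.symm).2.2 z hz ?_⟩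
  exact ⟨(negNbrs_antitone hP hy hz).2 h'.2, (negNbrs_antitone hP hz hx).2 h'.1⟩

/-- Here `(a, b)` and `(a₀, b₀)` stand for `v - s` and `c - s`, with `a` the coordinate that grows
from `c` to `v`. Eliminating `b₀` gives `L ≤ 2 * a - 2 * a₀` and `D₀ + L ≤ 3 * a + b - 2 * a₀`. -/
lemma length_bounds {a b a₀ b₀ D D₀ L : ℝ} (ha : 0 < a) (hb : 0 < b) (ha₀ : 0 < a₀)
    (hD : 0 ≤ D) (hsq : D ^ 2 = a ^ 2 + a * b + b ^ 2) (hD₀ : D₀ ≤ a₀ + b₀)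
    (hL : L ≤ (a - b) - (a₀ - b₀)) (hle : a₀ + b₀ ≤ a + b) : D₀ + L ≤ 3 * D ∧ L ≤ 2 * D := by
  have h1 : a ≤ D := by nlinarith
  have h2 : 3 * a + b ≤ 3 * D := by
    apply le_of_sq_le_sq _ (by positivity)
    -- The difference of the squares is `3 * a * b + 8 * b ^ 2`.
    nlinarith [mul_pos ha hb]
  constructor <;> linarith

lemma approximation_bounds (hP : GeneralPosition P) {s v c : P} {i : Fin 3}
    (hv : v ∈ negNbrs P s i) (hc : IsNegClosest P s i c) (q : (G9 P).Walk c v) (hq : q.IsPath)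
    (he : ∀ e ∈ q.edges, e ∈ (canonicalPath P s i).edgeSet) :
    dist s c + walkLength q ≤ 3 * dist s v ∧ walkLength q ≤ 2 * dist s v := by
  obtain ⟨v1, v2⟩ := ((mem_negNbrs_iff hP).1 hv).1
  obtain ⟨c1, c2⟩ := ((mem_negNbrs_iff hP).1 hc.1).1
  have hle : coord i v ≤ coord i c := by
    have h3 : 0 < √3 / 2 := by positivity
    have := hc.2 v hv
    rw [proj_negIdx, proj_negIdx, neg_le_neg_iff, proj_posIdx, proj_posIdx,
      mul_le_mul_iff_right₀ h3] at this
    linarith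
  rw [coord_sum i, coord_sum i] at hle
  have hsq : dist s v ^ 2 = _ := dist_sq_eq i s v
  have hD₀ : dist s c ≤ _ := dist_le_coord i s c
  rw [abs_of_neg (by linarith), abs_of_neg (by linarith)] at hD₀
  rcases le_total (coord (i + 1) c.1) (coord (i + 1) v.1) with h | h
  · have hL := (joinsConsecutive_fst hP s i).walkLength_le
      -- On an antichain the two coordinate changes have opposite signs, so the sum of their
      -- absolute values is the increment of this difference.
      (F := fun x => coord (i + 1) x.1 - coord (i + 2) x.1)
      (fun x _ y _ e => coord_injOn hP _ e) (fun x hx y hy hlt => by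
        have h2 := (negNbrs_antitone hP hx hy).1 hlt
        have h5 : dist x y ≤ _ := dist_le_coord i x y
        rw [abs_of_neg (by linarith), abs_of_pos (by linarith)] at h5
        linarith) q hq he hv h
    refine length_bounds (a := coord (i + 1) v.1 - coord (i + 1) s.1)
      (b := coord (i + 2) v.1 - coord (i + 2) s.1) (a₀ := coord (i + 1) c.1 - coord (i + 1) s.1)
      (b₀ := coord (i + 2) c.1 - coord (i + 2) s.1) ?_ ?_ ?_ dist_nonneg ?_ ?_ ?_ ?_ <;>
      linarith
  · have h' : coord (i + 2) c.1 ≤ coord (i + 2) v.1 := by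
      by_contra! h'
      exact absurd ((negNbrs_antitone hP hc.1 hv).2 h') (not_lt.2 h)
    have hL := (joinsConsecutive_snd hP s i).walkLength_le
      (F := fun x => coord (i + 2) x.1 - coord (i + 1) x.1)
      (fun x _ y _ e => coord_injOn hP _ e) (fun x hx y hy hlt => by
        have h2 := (negNbrs_antitone hP hy hx).2 hlt
        have h5 : dist x y ≤ _ := dist_le_coord i x y
        rw [abs_of_pos (by linarith), abs_of_neg (by linarith)] at h5
        linarith) q hq he hv h'
    refine length_bounds (b := coord (i + 1) v.1 - coord (i + 1) s.1)
      (a := coord (i + 2) v.1 - coord (i + 2) s.1) (b₀ := coord (i + 1) c.1 - coord (i + 1) s.1)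
      (a₀ := coord (i + 2) c.1 - coord (i + 2) s.1) ?_ ?_ ?_ dist_nonneg ?_ ?_ ?_ ?_ <;>
      linarith

lemma IsApproximationPath.walkLength_le (hP : GeneralPosition P) {s v : P} {i : Fin 3}
    (hv : v ∈ negNbrs P s i) {p : (G9 P).Walk s v} (hp : IsApproximationPath P i p) :
    walkLength p ≤ 3 * dist s v ∧ walkLength p.tail ≤ 2 * dist s v := by
  obtain ⟨c, h, q, rfl, hc, hq, he⟩ := hp
  obtain ⟨h1, h2⟩ := approximation_bounds hP hv hc q hq he
  refine ⟨by rwa [walkLength_cons], ?_⟩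
  -- The tail drops the edge from `s` to `c`, leaving the canonical part.
  have : walkLength (Walk.cons h q).tail = walkLength q := by
    simp [walkLength]
  rwa [this]

end Bound

end

end HalfTheta

theorem mainTheorem7 (P : Finset HalfTheta.Plane) (hP : HalfTheta.GeneralPosition P) :
    HalfTheta.IsSpanner 3 (HalfTheta.G9 P) (HalfTheta.halfTheta6 P) ∧
    ∀ (s v : P) (i : Fin 3), (HalfTheta.halfTheta6 P).Adj s v →
      v.1 ∈ HalfTheta.sector (HalfTheta.negIdx i) s →
      (∃ p : (HalfTheta.G9 P).Walk s v, HalfTheta.IsApproximationPath P i p) ∧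
      ∀ p : (HalfTheta.G9 P).Walk s v, HalfTheta.IsApproximationPath P i p →
        HalfTheta.walkLength p ≤ 3 * dist s v ∧
        HalfTheta.walkLength p.tail ≤ 2 * dist s v := by
  refine ⟨HalfTheta.isSpanner_of_forall_adj (by norm_num) HalfTheta.G9_le_halfTheta6
    fun u v h => ?_, fun s v i h hv => ⟨HalfTheta.exists_isApproximationPath hP ⟨h, hv⟩,
      fun p hp => hp.walkLength_le hP ⟨h, hv⟩⟩⟩
  obtain ⟨i, hv | hu⟩ := HalfTheta.exists_adj_negNbrs hP h
  · obtain ⟨p, hp⟩ := HalfTheta.exists_isApproximationPath hP hv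
    exact ⟨p, (hp.walkLength_le hP hv).1⟩
  · obtain ⟨p, hp⟩ := HalfTheta.exists_isApproximationPath hP hu
    refine ⟨p.reverse, ?_⟩
    rw [HalfTheta.walkLength_reverse, dist_comm]
    exact (hp.walkLength_le hP hu).1
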